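/- Let $G$ be a group and let $N\le L$ be normal subgroups of $G$. For a normal subgroup $M$ of $G$, let $[G,M]$ be the subgroup generated by the commutators $gxg^{-1}x^{-1}$ with $g\in G$, $x\in M$; let $\mathrm{cl}_{G,M}(y)$ be the least number of such commutators whose product is $y\in[G,M]$, let $\mathrm{scl}_{G,M}(y)=\lim_{n\to\infty}\mathrm{cl}_{G,M}(y^n)/n$, and let $d_{\mathrm{scl}_{G,M}}(y_1,y_2)=\mathrm{scl}_{G,M}(y_1^{-1}y_2)$ for $y_1,y_2\in[G,M]$. Let $\mathrm{Q}(M)^G$ be the real vector space of functions $\nu\colon M\to\mathbb{R}$ that are homogeneous ($\nu(x^n)=n\,\nu(x)$ for all $n\in\mathbb{Z}$), $G$-invariant ($\nu(gxg^{-1})=\nu(x)$ for all $g\in G$) and quasimorphisms ($\sup_{x,y\in M}|\nu(xy)-\nu(x)-\nu(y)|<\infty$), let $\mathrm{H}^1(M)^G\subseteq \mathrm{Q}(M)^G$ be the subspace of $G$-invariant homomorphisms $M\to\mathbb{R}$, and put $$\mathcal{W}(G,L,N)=\mathrm{Q}(N)^G/\bigl(\mathrm{H}^1(N)^G+\{\psi|_N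 : \psi\in \mathrm{Q}(L)^G\}\bigr),$$ with $\dim_{\mathbb{R}}\mathcal{W}(G,L,N)=\infty$ if this space is infinite dimensional. A set $A\subseteq[G,N]$ is called $d_{\mathrm{scl}_{G,L}}$-bounded if $\sup_{y_1,y_2\in A}d_{\mathrm{scl}_{G,L}}(y_1,y_2)<\infty$. A map $\beta\colon([G,N],d_{\mathrm{scl}_{G,N}})\to(\mathbb{Z}^\ell,\|\cdot\|_1)$ is a coarse homomorphism if $\sup_{y,z\in[G,N]}\|\beta(yz)-\beta(y)-\beta(z)\|_1<\infty$ and $\beta$ is controlled, that is, for every $S>0$ there is $T>0$ such that $d_{\mathrm{scl}_{G,N}}(y,z)\le S$ implies $\|\beta(y)-\beta(z)\|_1\le T$; a coarse homomorphism $(A,d_{\mathrm{scl}_{G,N}})\to(\mathbb{Z}^\ell,\|\cdot\|_1)$ on a subset $A\subseteq[G,N]$ is the restriction to $A$ of such a $\beta$. A map $\alpha\colon A\to\mathbb{Z}^\ell$ is coarsely proper if for every $S>0$ there is $T>0$ such that, for all $y,z\in A$, $d_{\mathrm{scl}_{G,N}}(y,z)>T$ implies $\|\alpha(y)-\alpha(z)\|_1>S$.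 The asymptotic dimension $\mathrm{asdim}(A,d)$ is the least $n\in\mathbb{Z}_{\ge0}$ (and $\infty$ if there is none) such that for every $r$ there are families $\mathcal{U}^0,\dots,\mathcal{U}^n$ of subsets of $A$, together covering $A$, whose members have uniformly bounded $d$-diameter, and such that $d(x,y)>r$ whenever $x\in U$, $y\in V$ with $U\ne V$ in the same family $\mathcal{U}^i$. Then $$\dim_{\mathbb{R}}\mathcal{W}(G,L,N)\ \ge\ \inf\left\{\ell\in\mathbb{Z}_{\ge0}\ \middle|\ \begin{array}{l}\text{for every } d_{\mathrm{scl}_{G,L}}\text{-bounded } A\subseteq[G,N] \text{ there is a coarsely proper}\\ \text{coarse homomorphism } (A,d_{\mathrm{scl}_{G,N}})\to(\mathbb{Z}^\ell,\|\cdot\|_1)\end{array}\right\},$$ where $\inf\emptyset=\infty$. In particular, $$\dim_{\mathbb{R}}\mathcal{W}(G,L,N)\ \ge\ \sup\{\mathrm{asdim}(A,d_{\mathrm{scl}_{G,N}}) \mid A\subseteq[G,N]\text{ is } d_{\mathrm{scl}_{G,L}}\text{-bounded}\}.$$ -/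

import Mathlib

open Filter Topology

namespace MixedScl

/-! ### Invariant quasimorphisms and the space `𝒲(G,L,N)` -/

section Quasimorphisms

variable {G : Type*} [Group G]

/-- `Q(N)^G`: the real vector space of homogeneous quasimorphisms on the normal subgroup `N`
that are invariant under conjugation by elements of `G`. -/
def invQuasimorphisms (N : Subgroup G) [N.Normal] : Submodule ℝ (N → ℝ) where
  carrier := {ν | (∃ D : ℝ, ∀ x y : N, |ν (x * y) - ν x - ν y| ≤ D) ∧
    (∀ (x : N) (n : ℤ), ν (x ^ n) = n * ν x) ∧
    ∀ (g : G) (x : N), ν (MulAut.conjNormal g x) = ν x}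
  zero_mem' := ⟨⟨0, by simp⟩, by simp, by simp⟩
  add_mem' := by
    rintro μ ν ⟨⟨D, hD⟩, hμ, hμ'⟩ ⟨⟨E, hE⟩, hν, hν'⟩
    refine ⟨⟨D + E, fun x y => ?_⟩, fun x n => ?_, fun g x => ?_⟩
    · have h : (μ + ν) (x * y) - (μ + ν) x - (μ + ν) y
          = (μ (x * y) - μ x - μ y) + (ν (x * y) - ν x - ν y) := by
        simp only [Pi.add_apply]; ring
      rw [h]
      exact (abs_add_le _ _).trans (add_le_add (hD x y) (hE x y))
    · simp only [Pi.add_apply, hμ, hν]; ring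
    · simp only [Pi.add_apply, hμ', hν']
  smul_mem' := by
    rintro c ν ⟨⟨D, hD⟩, hν, hν'⟩
    refine ⟨⟨|c| * D, fun x y => ?_⟩, fun x n => ?_, fun g x => ?_⟩
    · have h : (c • ν) (x * y) - (c • ν) x - (c • ν) y = c * (ν (x * y) - ν x - ν y) := by
        simp only [Pi.smul_apply, smul_eq_mul]; ring
      rw [h, abs_mul]
      exact mul_le_mul_of_nonneg_left (hD x y) (abs_nonneg c)
    · simp only [Pi.smul_apply, smul_eq_mul, hν]; ring
    · simp only [Pi.smul_apply, hν']

/-- `H¹(N)^G`: the real vector space of homomorphisms `N → ℝ` that are invariant under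
conjugation by elements of `G`. -/
def invHoms (N : Subgroup G) [N.Normal] : Submodule ℝ (N → ℝ) where
  carrier := {ν | (∀ x y : N, ν (x * y) = ν x + ν y) ∧
    ∀ (g : G) (x : N), ν (MulAut.conjNormal g x) = ν x}
  zero_mem' := ⟨by simp, by simp⟩
  add_mem' := by
    rintro μ ν ⟨hμ, hμ'⟩ ⟨hν, hν'⟩
    refine ⟨fun x y => ?_, fun g x => ?_⟩
    · simp only [Pi.add_apply, hμ, hν]; ring
    · simp only [Pi.add_apply, hμ', hν']
  smul_mem' := by
    rintro c ν ⟨hν, hν'⟩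
    refine ⟨fun x y => ?_, fun g x => ?_⟩
    · simp only [Pi.smul_apply, smul_eq_mul, hν]; ring
    · simp only [Pi.smul_apply, hν']

/-- `i^* Q(L)^G`: the restrictions to `N` of the elements of `Q(L)^G`. -/
def restrictedQuasimorphisms (L N : Subgroup G) [L.Normal] (h : N ≤ L) : Submodule ℝ (N → ℝ) :=
  (invQuasimorphisms L).map (LinearMap.funLeft ℝ ℝ (Subgroup.inclusion h))

/-- `H¹(N)^G + i^* Q(L)^G` is contained in `Q(N)^G`. -/
theorem sup_le_invQuasimorphisms (L N : Subgroup G) [L.Normal] [N.Normal] (h : N ≤ L) :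
    invHoms N ⊔ restrictedQuasimorphisms L N h ≤ invQuasimorphisms N := by
  refine sup_le ?_ ?_
  · rintro ν ⟨hν, hν'⟩
    refine ⟨⟨0, fun x y => by simp [hν]⟩, fun x n => ?_, hν'⟩
    have := map_zpow (MonoidHom.mk' (M := N) (G := Multiplicative ℝ)
      (fun x => Multiplicative.ofAdd (ν x)) (fun x y => by rw [hν]; rfl)) x n
    have h2 := congrArg Multiplicative.toAdd this
    simpa using h2
  · rintro _ ⟨ψ, ⟨⟨D, hD⟩, hψ, hψ'⟩, rfl⟩
    refine ⟨⟨D, fun x y => ?_⟩, fun x n => ?_, fun g x => ?_⟩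
    · simpa [LinearMap.funLeft_apply] using
        hD (Subgroup.inclusion h x) (Subgroup.inclusion h y)
    · simpa [LinearMap.funLeft_apply] using hψ (Subgroup.inclusion h x) n
    · have h1 : Subgroup.inclusion h (MulAut.conjNormal g x)
          = MulAut.conjNormal g (Subgroup.inclusion h x) := Subtype.ext (by simp)
      simp only [LinearMap.funLeft_apply, h1, hψ']

/-- The real vector space `𝒲(G,L,N) = Q(N)^G / (H¹(N)^G + i^* Q(L)^G)`. -/
abbrev WSpace (L N : Subgroup G) [L.Normal] [N.Normal] (h : N ≤ L) : Type _ :=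
  invQuasimorphisms N ⧸
    (invHoms N ⊔ restrictedQuasimorphisms L N h).submoduleOf (invQuasimorphisms N)

/-- The dimension of `𝒲(G,L,N)`, with value `⊤` if the space is infinite dimensional. -/
noncomputable def dimW (L N : Subgroup G) [L.Normal] [N.Normal] (h : N ≤ L) : ℕ∞ :=
  Cardinal.toENat (Module.rank ℝ (WSpace L N h))

end Quasimorphisms

/-! ### Mixed commutator length and stable mixed commutator length -/

section Length

variable {G : Type*} [Group G]

/-- The mixed commutator subgroup `[G,N]`. -/
abbrev mixedCommutator (N : Subgroup G) : Subgroup G := ⁅(⊤ : Subgroup G), N⁆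

/-- The elements of `G` that are products of `n` simple `(G,N)`-commutators
`g * x * g⁻¹ * x⁻¹` with `g ∈ G` and `x ∈ N`. -/
def IsProdOfCommutators (N : Subgroup G) (n : ℕ) (y : G) : Prop :=
  ∃ l : List G, l.length = n ∧ (∀ s ∈ l, ∃ g : G, ∃ x ∈ N, s = g * x * g⁻¹ * x⁻¹) ∧ l.prod = y

/-- The mixed commutator length `cl_{G,N}` (used for elements of `[G,N]` only). -/
noncomputable def cl (N : Subgroup G) (y : G) : ℕ := sInf {n | IsProdOfCommutators N n y}

/-- The stable mixed commutator length `scl_{G,N}` (used for elements of `[G,N]` only). -/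
noncomputable def scl (N : Subgroup G) (y : G) : ℝ :=
  limUnder atTop fun n : ℕ => (cl N (y ^ n) : ℝ) / n

theorem IsProdOfCommutators.mul {N : Subgroup G} {m n : ℕ} {y z : G}
    (hy : IsProdOfCommutators N m y) (hz : IsProdOfCommutators N n z) :
    IsProdOfCommutators N (m + n) (y * z) := by
  obtain ⟨l, rfl, hl, rfl⟩ := hy
  obtain ⟨k, rfl, hk, rfl⟩ := hz
  refine ⟨l ++ k, by simp, fun s hs => ?_, by simp⟩
  rcases List.mem_append.1 hs with h | h
  exacts [hl s h, hk s h]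

/-- Every element of `[G,N]` is a product of simple `(G,N)`-commutators. -/
theorem exists_isProdOfCommutators {N : Subgroup G} {y : G} (hy : y ∈ mixedCommutator N) :
    ∃ n, IsProdOfCommutators N n y := by
  rw [mixedCommutator, Subgroup.commutator_def] at hy
  induction hy using Subgroup.closure_induction'' with
  | mem s hs =>
    obtain ⟨g, -, x, hx, rfl⟩ := hs
    refine ⟨1, [g * x * g⁻¹ * x⁻¹], rfl, ?_, by simp [commutatorElement_def]⟩
    intro s hs
    exact ⟨g, x, hx, List.mem_singleton.1 hs⟩
  | inv_mem s hs =>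
    obtain ⟨g, -, x, hx, rfl⟩ := hs
    refine ⟨1, [(g * x * g⁻¹ * x⁻¹)⁻¹], rfl, ?_, by simp [commutatorElement_def]⟩
    intro s hs
    rw [List.mem_singleton.1 hs]
    exact ⟨x * g * x⁻¹, x⁻¹, N.inv_mem hx, by group⟩
  | one => exact ⟨0, [], rfl, by simp, by simp⟩
  | mul y z _ _ hy hz =>
    obtain ⟨m, hm⟩ := hy
    obtain ⟨n, hn⟩ := hz
    exact ⟨m + n, hm.mul hn⟩

/-- The limit that defines `scl_{G,N} y` exists for every `y ∈ [G,N]`. -/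
theorem tendsto_scl {N : Subgroup G} {y : G} (hy : y ∈ mixedCommutator N) :
    Tendsto (fun n : ℕ => (cl N (y ^ n) : ℝ) / n) atTop (𝓝 (scl N y)) := by
  have hmem : ∀ n : ℕ, IsProdOfCommutators N (cl N (y ^ n)) (y ^ n) := fun n =>
    Nat.sInf_mem (exists_isProdOfCommutators ((mixedCommutator N).pow_mem hy n))
  have hsub : Subadditive fun n : ℕ => (cl N (y ^ n) : ℝ) := fun m n => by
    have h : cl N (y ^ (m + n)) ≤ cl N (y ^ m) + cl N (y ^ n) :=
      Nat.sInf_le (by rw [pow_add]; exact (hmem m).mul (hmem n))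
    simpa only [Nat.cast_add] using (Nat.cast_le (α := ℝ)).2 h
  refine tendsto_nhds_limUnder ⟨hsub.lim, hsub.tendsto_lim ⟨0, ?_⟩⟩
  rintro _ ⟨n, rfl⟩
  positivity

/-- The almost metric `d_{scl_{G,N}}` on `[G,N]`, `(y₁, y₂) ↦ scl_{G,N} (y₁⁻¹ y₂)`. -/
noncomputable def dscl (N : Subgroup G) (y₁ y₂ : mixedCommutator N) : ℝ :=
  scl N ((y₁ : G)⁻¹ * y₂)

/-- The restriction to `[G,N]` of the almost metric `d_{scl_{G,L}}` on `[G,L]`, for `N ≤ L`. -/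
noncomputable def dsclRestrict (L N : Subgroup G) (h : N ≤ L) (y₁ y₂ : mixedCommutator N) : ℝ :=
  dscl L (Subgroup.inclusion (Subgroup.commutator_mono le_rfl h) y₁)
    (Subgroup.inclusion (Subgroup.commutator_mono le_rfl h) y₂)

end Length

/-! ### Coarse geometry of almost metric spaces -/

section Coarse

variable {X Y : Type*}

/-- The restriction of an (almost) metric to a subset. -/
def restrictDist (d : X → X → ℝ) (A : Set X) (a b : A) : ℝ := d a b

/-- `A` is `d`-bounded: it has finite `d`-diameter. -/
def IsBoundedFor (d : X → X → ℝ) (A : Set X) : Prop := ∃ C : ℝ, ∀ x ∈ A, ∀ y ∈ A, d x y ≤ C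

/-- Controlled maps. -/
def IsControlled (dX : X → X → ℝ) (dY : Y → Y → ℝ) (α : X → Y) : Prop :=
  ∀ S > 0, ∃ T > 0, ∀ x x' : X, dX x x' ≤ S → dY (α x) (α x') ≤ T

/-- Coarsely proper maps. -/
def IsCoarselyProper (dX : X → X → ℝ) (dY : Y → Y → ℝ) (α : X → Y) : Prop :=
  ∀ S > 0, ∃ T > 0, ∀ x x' : X, T < dX x x' → S < dY (α x) (α x')

/-- The `ℓ¹`-metric on `ℤ^ℓ`. -/
def l1Dist {ℓ : ℕ} (m n : Fin ℓ → ℤ) : ℝ := ∑ i, |(m i : ℝ) - n i|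

/-- A coarse homomorphism from a group with a bi-invariant almost metric to `(ℤ^ℓ, ‖·‖₁)`:
a controlled map that preserves the group operations up to a uniformly bounded error. -/
def IsCoarseHom {H : Type*} [Group H] (d : H → H → ℝ) {ℓ : ℕ} (α : H → Fin ℓ → ℤ) : Prop :=
  IsControlled d l1Dist α ∧ ∃ C : ℝ, ∀ y z : H, l1Dist (α (y * z)) (α y + α z) ≤ C

/-- A coarse homomorphism `(A, d) → (ℤ^ℓ, ‖·‖₁)` on a subset `A` (not assumed to be closed under
the group operation) of a group with a bi-invariant almost metric: the restriction to `A` of a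
coarse homomorphism on the group. In particular such a map `α` is controlled, and `α a + α b` is
uniformly close to `α c` whenever `a, b, c ∈ A` and `a * b` is uniformly close to `c`. -/
def IsCoarseHomOn {H : Type*} [Group H] (d : H → H → ℝ) (A : Set H) {ℓ : ℕ}
    (α : A → Fin ℓ → ℤ) : Prop :=
  ∃ β : H → Fin ℓ → ℤ, IsCoarseHom d β ∧ ∀ a : A, α a = β a

/-- `asdim (X,d) ≤ n`: for every `r` there are `n + 1` uniformly bounded `r`-disjoint families
of subsets of `X` that together cover `X`. -/
def AsdimLE (d : X → X → ℝ) (n : ℕ) : Prop :=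
  ∀ r : ℝ, ∃ 𝒰 : Fin (n + 1) → Set (Set X),
    (∀ i, ∀ U ∈ 𝒰 i, ∀ V ∈ 𝒰 i, U ≠ V → ∀ x ∈ U, ∀ y ∈ V, r < d x y) ∧
    (∃ D : ℝ, ∀ i, ∀ U ∈ 𝒰 i, ∀ x ∈ U, ∀ y ∈ U, d x y ≤ D) ∧
    ∀ x : X, ∃ i, ∃ U ∈ 𝒰 i, x ∈ U

/-- The asymptotic dimension of an almost metric space, with values in `ℕ ∪ {∞}`. -/
noncomputable def asdim (d : X → X → ℝ) : ℕ∞ := ⨅ (n : ℕ) (_ : AsdimLE d n), (n : ℕ∞)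

end Coarse

end MixedScl

open MixedScl

/-!
Suppose that `𝒲(G,L,N)` has finite dimension `ℓ`, and let `ν₁, …, ν_ℓ ∈ Q(N)^G` represent a basis.
Every `ν ∈ Q(N)^G` is a combination of the `νᵢ`, an invariant homomorphism and the restriction of
some `ψ ∈ Q(L)^G`. On `[G,N]` the homomorphism vanishes and `ψ` is `O(scl_{G,L})`, so `ν` is
`O(q)` there for the function `q = 1 + ∑ |νᵢ| + scl_{G,L}`. A uniform form of Bavard duality
(`exists_scl_le_of_forall_invQuasimorphisms`) turns this into `scl_{G,N} = O(q)` on `[G,N]`.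
Hence on a set with `scl_{G,L}` bounded the map `y ↦ (⌊ν₁ y⌋, …, ⌊ν_ℓ y⌋)` is coarsely proper, and
it is a coarse homomorphism because the `νᵢ` are quasimorphisms of size `O(scl_{G,N})`. The bound
on the asymptotic dimension follows by pulling back a covering of `ℤ^ℓ` (`asdimLE_l1Dist`).

For the duality, consider functions `ℝ → N` modulo those that, for `t ≥ 0`, take values in a finite
set times the products of boundedly many `(G,N)`-commutators. As a commutator of two functions is
pointwise one commutator, this quotient is an abelian group (`GrowthClass`), and
`r x ↦ (t ↦ x ^ ⌊r t⌋)` extends to an additive map `chainClass` on the real chains `ℝ[N]`. The rate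
at which the commutator length of the image of a chain grows is a seminorm `rateSeminorm` on a
subspace `ratedChains` of `ℝ[N]`. The relators `x ^ n - n x` and `g x g⁻¹ - x` have rate `0`, the
relators `x y - x - y` have rate at most `1`, and a chain `y ∈ [G,N]` has rate at least
`scl_{G,N} y`. So every linear functional that is bounded for this seminorm, once extended linearly
to `ℝ[N]`, is an element of `Q(N)^G` (`functional_mem_invQuasimorphisms`). If all of these are
`O(q)` on `[G,N]`, the Banach–Steinhaus theorem on the dual of the seminormed space of chains,
together with the Hahn–Banach theorem, shows that `scl_{G,N}` is `O(q)`.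
-/

namespace MixedScl

/-! ### Asymptotic dimension of `ℤ^ℓ` -/

/-- `ℤ^ℓ` has asymptotic dimension at most `ℓ`. With `m = (ℓ + 1) R`, the walls of colour
`j ≤ ℓ` are the coordinates `n` with `n - j R ≡ 0, …, R - 1` modulo `m`. The walls of different
colours are disjoint, so the `ℓ` coordinates of a point cannot meet the walls of all `ℓ + 1`
colours; the boxes cut out by the walls of one fixed colour are bounded and `R`-disjoint. -/
theorem asdimLE_l1Dist (ℓ : ℕ) : AsdimLE (l1Dist (ℓ := ℓ)) ℓ := by
  intro r
  obtain ⟨R₀, hR₀⟩ := exists_nat_gt r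
  set R : ℤ := R₀ + 1 with hR
  have hRpos : 0 < R := by omega
  set m : ℤ := (ℓ + 1) * R with hm
  have hmpos : 0 < m := by positivity
  let box (j : Fin (ℓ + 1)) (c : Fin ℓ → ℤ) : Set (Fin ℓ → ℤ) :=
    {x | ∀ i, R ≤ (x i - j * R) % m ∧ (x i - j * R) / m = c i}
  have hdiv : ∀ a : ℤ, a = m * (a / m) + a % m := fun a => (Int.mul_ediv_add_emod a m).symm
  -- coordinates in different components of the complement of a wall are more than `r` apart
  have hsep : ∀ a b : ℤ, a / m < b / m → R ≤ b % m → r < |(a : ℝ) - b| := by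
    intro a b hab hb
    have h1 : m * (a / m + 1) ≤ m * (b / m) := mul_le_mul_of_nonneg_left hab hmpos.le
    have h2 := Int.emod_lt_of_pos a hmpos
    have h3 := hdiv a
    have h4 := hdiv b
    have h5 : R < b - a := by linarith
    have h6 : (R : ℝ) < b - a := by exact_mod_cast h5
    have h7 : (R : ℝ) = R₀ + 1 := by rw [hR]; push_cast; ring
    rw [abs_sub_comm]
    exact lt_of_lt_of_le (by linarith) (le_abs_self _)
  refine ⟨fun j => Set.range (box j), ?_, ⟨ℓ * m, ?_⟩, ?_⟩
  · rintro j _ ⟨c, rfl⟩ _ ⟨c', rfl⟩ hne x hx y hy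
    have hcc : c ≠ c' := fun h => hne (by rw [h])
    obtain ⟨i, hi⟩ := Function.ne_iff.1 hcc
    refine lt_of_lt_of_le ?_ (Finset.single_le_sum (f := fun i => |(x i : ℝ) - y i|)
      (fun _ _ => abs_nonneg _) (Finset.mem_univ i))
    have key : r < |((x i - j * R : ℤ) : ℝ) - ((y i - j * R : ℤ) : ℝ)| := by
      rcases lt_or_gt_of_ne hi with hlt | hgt
      · exact hsep _ _ (by rw [(hx i).2, (hy i).2]; exact hlt) (hy i).1
      · rw [abs_sub_comm]
        exact hsep _ _ (by rw [(hx i).2, (hy i).2]; exact hgt) (hx i).1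
    simpa using key
  · rintro j _ ⟨c, rfl⟩ x hx y hy
    have hle : ∀ i ∈ Finset.univ, |(x i : ℝ) - y i| ≤ m := by
      intro i _
      have hx1 := hdiv (x i - j * R)
      have hy1 := hdiv (y i - j * R)
      rw [(hx i).2] at hx1
      rw [(hy i).2] at hy1
      have h1 := Int.emod_lt_of_pos (x i - j * R) hmpos
      have h2 := Int.emod_lt_of_pos (y i - j * R) hmpos
      have h3 := Int.emod_nonneg (x i - j * R) hmpos.ne'
      have h4 := Int.emod_nonneg (y i - j * R) hmpos.ne'
      have h5 : |x i - y i| ≤ m := abs_le.2 ⟨by linarith, by linarith⟩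
      exact_mod_cast h5
    simpa [l1Dist] using Finset.sum_le_sum hle
  · intro x
    have hcol : ∀ i, (x i % m / R).toNat < ℓ + 1 := by
      intro i
      have h1 : x i % m / R < ℓ + 1 :=
        Int.ediv_lt_of_lt_mul hRpos (Int.emod_lt_of_pos _ hmpos)
      omega
    -- a colour whose walls contain no coordinate of `x`
    obtain ⟨j, hj⟩ : ∃ j : Fin (ℓ + 1), ∀ i, (⟨_, hcol i⟩ : Fin (ℓ + 1)) ≠ j := by
      by_contra! hcon
      have := Fintype.card_le_of_surjective (fun i => (⟨_, hcol i⟩ : Fin (ℓ + 1))) hcon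
      simp at this
    refine ⟨j, box j fun i => (x i - j * R) / m, ⟨_, rfl⟩, fun i => ⟨?_, rfl⟩⟩
    by_contra! hlt
    refine hj i (Fin.ext ?_)
    set s := (x i - j * R) % m with hs
    have hs0 : 0 ≤ s := Int.emod_nonneg _ hmpos.ne'
    have hjle : (j : ℤ) ≤ ℓ := by have := j.2; omega
    have h1 : x i % m = j * R + s := by
      have h2 : x i = (j * R + s) + m * ((x i - j * R) / m) := by
        have := hdiv (x i - j * R)
        linarith
      rw [h2, Int.add_mul_emod_self_left]
      refine Int.emod_eq_of_lt (by positivity) ?_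
      have : (j : ℤ) * R ≤ ℓ * R := mul_le_mul_of_nonneg_right hjle hRpos.le
      rw [hm]
      linarith
    have h3 : x i % m / R = j := by
      rw [h1, add_comm, Int.add_mul_ediv_right _ _ hRpos.ne', Int.ediv_eq_zero_of_lt hs0 hlt,
        zero_add]
    simp only [h3, Int.toNat_natCast]

/-- A controlled and coarsely proper map does not lower the asymptotic dimension. -/
theorem AsdimLE.of_isControlled {X Y : Type*} {dX : X → X → ℝ} {dY : Y → Y → ℝ} {n : ℕ}
    (hY : AsdimLE dY n) {α : X → Y} (hα : IsControlled dX dY α)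
    (hα' : IsCoarselyProper dX dY α) : AsdimLE dX n := by
  intro r
  obtain ⟨T, -, hT⟩ := hα (max r 1) (by positivity)
  obtain ⟨𝒰, hdisj, ⟨D, hD⟩, hcov⟩ := hY T
  obtain ⟨T', -, hT'⟩ := hα' (max D 1) (by positivity)
  refine ⟨fun i => Set.preimage α '' 𝒰 i, ?_, ⟨T', ?_⟩, ?_⟩
  · rintro i _ ⟨U, hU, rfl⟩ _ ⟨V, hV, rfl⟩ hne x hx y hy
    by_contra! hle
    exact absurd (hT x y (hle.trans (le_max_left _ _)))
      (not_le.2 (hdisj i U hU V hV (fun h => hne (by rw [h])) _ hx _ hy))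
  · rintro i _ ⟨U, hU, rfl⟩ x hx y hy
    by_contra! hlt
    exact absurd (hT' x y hlt) (not_lt.2 ((hD i U hU _ hx _ hy).trans (le_max_left _ _)))
  · intro x
    obtain ⟨i, U, hU, hxU⟩ := hcov (α x)
    exact ⟨i, _, ⟨U, hU, rfl⟩, hxU⟩

/-! ### Uniform boundedness for seminormed spaces -/

/-- A weakly bounded family in a seminormed space is bounded, in a weighted form: if every
linear functional dominated by a multiple of `p` is `O(q)` along the family `v`, then so is `p`.
This is the Banach–Steinhaus theorem on the dual of `(E, p)`, which is complete even if `(E, p)`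
is not, together with the Hahn–Banach theorem. -/
theorem exists_seminorm_le_of_forall_functional {E ι : Type*} [AddCommGroup E] [Module ℝ E]
    (p : Seminorm ℝ E) (v : ι → E) (q : ι → ℝ) (hq : ∀ i, 0 < q i)
    (H : ∀ f : E →ₗ[ℝ] ℝ, (∃ C, ∀ x, |f x| ≤ C * p x) → ∃ K, ∀ i, |f (v i)| ≤ K * q i) :
    ∃ K, ∀ i, p (v i) ≤ K * q i := by
  let _ : SeminormedAddCommGroup E := p.toAddGroupSeminorm.toSeminormedAddCommGroup
  let _ : NormedSpace ℝ E := ⟨fun a x => (map_smul_eq_mul p a x).le⟩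
  have hnorm : ∀ x : E, ‖x‖ = p x := fun _ => rfl
  obtain ⟨K, hK⟩ := banach_steinhaus
    (g := fun i => NormedSpace.inclusionInDoubleDual ℝ E ((q i)⁻¹ • v i)) (fun f => by
      obtain ⟨K, hK⟩ := H f.toLinearMap ⟨‖f‖, fun x => by
        simpa [hnorm] using f.le_opNorm x⟩
      refine ⟨K, fun i => ?_⟩
      rw [NormedSpace.dual_def, map_smul, norm_smul, norm_inv, Real.norm_of_nonneg (hq i).le,
        inv_mul_le_iff₀ (hq i), mul_comm]
      exact hK i)
  refine ⟨K, fun i => ?_⟩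
  obtain ⟨f, hf1, hf⟩ := exists_dual_vector'' ℝ ((q i)⁻¹ • v i)
  have h1 : ‖(q i)⁻¹ • v i‖ ≤ K := by
    have h2 := (NormedSpace.inclusionInDoubleDual ℝ E ((q i)⁻¹ • v i)).le_opNorm f
    rw [NormedSpace.dual_def, hf] at h2
    simp only [RCLike.ofReal_real_eq_id, id_eq, norm_norm] at h2
    exact h2.trans ((mul_le_of_le_one_right (norm_nonneg _) hf1).trans (hK i))
  rwa [norm_smul, norm_inv, Real.norm_of_nonneg (hq i).le, inv_mul_le_iff₀ (hq i), mul_comm] at h1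

/-! ### Products of mixed commutators -/

section Products

variable {G : Type*} [Group G] {N : Subgroup G}

theorem isProdOfCommutators_zero (N : Subgroup G) : IsProdOfCommutators N 0 1 :=
  ⟨[], rfl, by simp, by simp⟩

theorem isProdOfCommutators_one (g : G) {x : G} (hx : x ∈ N) :
    IsProdOfCommutators N 1 (g * x * g⁻¹ * x⁻¹) :=
  ⟨[g * x * g⁻¹ * x⁻¹], rfl, fun _ hs => ⟨g, x, hx, List.mem_singleton.1 hs⟩, by simp⟩

theorem IsProdOfCommutators.inv {n : ℕ} {y : G} (hy : IsProdOfCommutators N n y) :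
    IsProdOfCommutators N n y⁻¹ := by
  obtain ⟨l, rfl, hl, rfl⟩ := hy
  refine ⟨(l.map (·⁻¹)).reverse, by simp, fun s hs => ?_, (List.prod_inv_reverse l).symm⟩
  obtain ⟨t, ht, rfl⟩ := List.mem_map.1 (List.mem_reverse.1 hs)
  obtain ⟨g, x, hx, rfl⟩ := hl t ht
  exact ⟨x * g * x⁻¹, x⁻¹, N.inv_mem hx, by group⟩

theorem IsProdOfCommutators.conj [N.Normal] {n : ℕ} {y : G} (hy : IsProdOfCommutators N n y)
    (g : G) : IsProdOfCommutators N n (g * y * g⁻¹) := by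
  obtain ⟨l, rfl, hl, rfl⟩ := hy
  refine ⟨l.map (MulAut.conj g), by simp, fun s hs => ?_, ?_⟩
  · obtain ⟨t, ht, rfl⟩ := List.mem_map.1 hs
    obtain ⟨a, x, hx, rfl⟩ := hl t ht
    exact ⟨g * a * g⁻¹, g * x * g⁻¹, Subgroup.Normal.conj_mem ‹_› x hx g, by
      simp only [MulAut.conj_apply]; group⟩
  · rw [← MulAut.conj_apply, map_list_prod]

theorem IsProdOfCommutators.pow {n : ℕ} {y : G} (hy : IsProdOfCommutators N n y) (k : ℕ) :
    IsProdOfCommutators N (k * n) (y ^ k) := by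
  induction k with
  | zero => simpa using isProdOfCommutators_zero N
  | succ k ih => rw [pow_succ, Nat.succ_mul]; exact ih.mul hy

theorem IsProdOfCommutators.mem {n : ℕ} {y : G} (hy : IsProdOfCommutators N n y) :
    y ∈ mixedCommutator N := by
  obtain ⟨l, rfl, hl, rfl⟩ := hy
  refine Subgroup.list_prod_mem _ fun s hs => ?_
  obtain ⟨g, x, hx, rfl⟩ := hl s hs
  exact Subgroup.commutator_mem_commutator (Subgroup.mem_top g) hx

theorem isProdOfCommutators_cl {y : G} (hy : y ∈ mixedCommutator N) :
    IsProdOfCommutators N (cl N y) y :=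
  Nat.sInf_mem (exists_isProdOfCommutators hy)

theorem IsProdOfCommutators.cl_le {n : ℕ} {y : G} (hy : IsProdOfCommutators N n y) :
    cl N y ≤ n := Nat.sInf_le hy

/-- `(x y)^n` differs from `x^n y^n` by at most `n` mixed commutators. -/
theorem isProdOfCommutators_mul_pow [N.Normal] (x : G) {y : G} (hy : y ∈ N) (n : ℕ) :
    IsProdOfCommutators N n ((x ^ n * y ^ n)⁻¹ * (x * y) ^ n) := by
  induction n with
  | zero => simpa using isProdOfCommutators_zero N
  | succ n ih =>
    have h1 := (isProdOfCommutators_one (N := N) (x ^ n)⁻¹ hy).conj (y ^ (n + 1))⁻¹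
    have h2 := h1.mul ih
    rw [add_comm 1 n] at h2
    convert h2 using 1
    rw [pow_succ' (x * y), pow_succ' x, pow_succ' y]
    generalize (x * y) ^ n = w
    group

theorem scl_nonneg {y : G} (hy : y ∈ mixedCommutator N) : 0 ≤ scl N y :=
  ge_of_tendsto' (tendsto_scl hy) fun n => by positivity

theorem scl_le_of_cl_pow_le {y : G} (hy : y ∈ mixedCommutator N) {C K : ℝ}
    (h : ∀ n : ℕ, (cl N (y ^ n) : ℝ) ≤ C * n + K) : scl N y ≤ C := by
  have h1 : Tendsto (fun n : ℕ => C + K / n) atTop (𝓝 (C + 0)) :=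
    tendsto_const_nhds.add (tendsto_const_div_atTop_nhds_zero_nat K)
  rw [add_zero] at h1
  refine le_of_tendsto_of_tendsto (tendsto_scl hy) h1 ?_
  filter_upwards [eventually_gt_atTop 0] with n hn
  have hn' : (0 : ℝ) < n := by exact_mod_cast hn
  rw [div_le_iff₀ hn', add_mul, div_mul_cancel₀ _ hn'.ne']
  exact h n

end Products

/-! ### Invariant quasimorphisms on the mixed commutator subgroup -/

section Values

variable {G : Type*} [Group G] {N : Subgroup G} [N.Normal]

theorem mixedCommutator_le (N : Subgroup G) [N.Normal] : mixedCommutator N ≤ N :=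
  Subgroup.commutator_le_right _ _

theorem invQuasimorphisms_inv {ν : N → ℝ} (hν : ν ∈ invQuasimorphisms N) (x : N) :
    ν x⁻¹ = -ν x := by
  simpa using hν.2.1 x (-1)

theorem invQuasimorphisms_one {ν : N → ℝ} (hν : ν ∈ invQuasimorphisms N) : ν 1 = 0 := by
  simpa using hν.2.1 1 0

/-- A homogeneous invariant quasimorphism of defect `D` is at most `D` on a mixed commutator,
hence at most `2 D n` on a product of `n` of them. -/
theorem abs_le_of_isProdOfCommutators {ν : N → ℝ} (hν : ν ∈ invQuasimorphisms N) {D : ℝ}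
    (hD : ∀ x y : N, |ν (x * y) - ν x - ν y| ≤ D) {n : ℕ} {y : N}
    (hy : IsProdOfCommutators N n (y : G)) : |ν y| ≤ 2 * D * n := by
  have hcomm : ∀ (g : G) (x : N), |ν (MulAut.conjNormal g x * x⁻¹)| ≤ D := by
    intro g x
    have h := hD (MulAut.conjNormal g x) x⁻¹
    rw [hν.2.2, invQuasimorphisms_inv hν] at h
    simpa using h
  obtain ⟨l, rfl, hl, hly⟩ := hy
  induction l generalizing y with
  | nil =>
    have : y = 1 := Subtype.ext (by simpa using hly.symm)
    simp [this, invQuasimorphisms_one hν]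
  | cons s l ih =>
    obtain ⟨g, x, hx, hs⟩ := hl s (by simp)
    set c : N := MulAut.conjNormal g ⟨x, hx⟩ * (⟨x, hx⟩ : N)⁻¹ with hc
    have hcs : (c : G) = s := by rw [hs]; simp [hc]
    have h1 := ih (y := c⁻¹ * y) (fun t ht => hl t (by simp [ht])) (by
      rw [Subgroup.coe_mul, ← hly, Subgroup.coe_inv, hcs]; simp)
    have h2 := hD c (c⁻¹ * y)
    rw [mul_inv_cancel_left] at h2
    have h3 : |ν c| ≤ D := hcomm g ⟨x, hx⟩
    rw [List.length_cons, Nat.cast_succ]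
    rw [abs_le] at *
    constructor <;> linarith [h1.1, h1.2, h2.1, h2.2, h3.1, h3.2]

/-- The elementary half of Bavard duality: an invariant homogeneous quasimorphism is bounded on
`[G,N]` by a multiple of `scl_{G,N}`. -/
theorem exists_abs_le_mul_scl {ν : N → ℝ} (hν : ν ∈ invQuasimorphisms N) :
    ∃ C, 0 ≤ C ∧ ∀ y : N, (y : G) ∈ mixedCommutator N → |ν y| ≤ C * scl N (y : G) := by
  obtain ⟨D, hD⟩ := hν.1
  refine ⟨2 * D, by linarith [(abs_nonneg _).trans (hD 1 1)], fun y hy => ?_⟩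
  refine le_of_tendsto_of_tendsto tendsto_const_nhds ((tendsto_scl hy).const_mul (2 * D)) ?_
  filter_upwards [eventually_gt_atTop 0] with n hn
  have hn' : (0 : ℝ) < n := by exact_mod_cast hn
  have h1 := abs_le_of_isProdOfCommutators hν hD (y := y ^ n)
    (by simpa using isProdOfCommutators_cl ((mixedCommutator N).pow_mem hy n))
  have h2 : ν (y ^ n) = n * ν y := by simpa using hν.2.1 y n
  rw [h2, abs_mul, Nat.abs_cast] at h1
  rw [← mul_div_assoc, le_div_iff₀ hn', mul_comm]
  simpa using h1

theorem invHoms_apply_eq_zero {ν : N → ℝ} (hν : ν ∈ invHoms N) {y : N}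
    (hy : (y : G) ∈ mixedCommutator N) : ν y = 0 := by
  have hν' : ν ∈ invQuasimorphisms N := by
    have h := sup_le_invQuasimorphisms N N le_rfl
    exact h (Submodule.mem_sup_left hν)
  have h := abs_le_of_isProdOfCommutators hν' (D := 0) (fun x y => by simp [hν.1])
    (isProdOfCommutators_cl hy)
  simpa using h

end Values

/-! ### Growth of sequences of commutators -/

section Growth

variable {G : Type*} [Group G] {N : Subgroup G}

/-- `u : ℝ → N` has growth rate at most `C`: for `t ≥ 0` the element `u t` is, up to a factor
from a fixed finite set, a product of at most `C t + K` mixed commutators. The finite set absorbs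
the rounding errors that come from replacing real exponents by integers. -/
def GrowthLE (N : Subgroup G) (C : ℝ) (u : ℝ → N) : Prop :=
  ∃ F : Set N, F.Finite ∧ ∃ K : ℝ, ∀ t : ℝ, 0 ≤ t → ∃ f ∈ F, ∃ m : ℕ,
    (m : ℝ) ≤ C * t + K ∧ IsProdOfCommutators N m ((f⁻¹ * u t : N) : G)

/-- Growth with trivial finite part: `u` itself has commutator length at most `C t + K`. -/
theorem GrowthLE.of_isProdOfCommutators {C K : ℝ} {u : ℝ → N}
    (h : ∀ t : ℝ, 0 ≤ t → ∃ m : ℕ, (m : ℝ) ≤ C * t + K ∧ IsProdOfCommutators N m (u t : G)) :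
    GrowthLE N C u :=
  ⟨{1}, Set.finite_singleton 1, K, fun t ht => by
    obtain ⟨m, hm, hu⟩ := h t ht
    exact ⟨1, rfl, m, hm, by simpa using hu⟩⟩

theorem growthLE_of_finite {u : ℝ → N} {F : Set N} (hF : F.Finite) (h : ∀ t, u t ∈ F) :
    GrowthLE N 0 u :=
  ⟨F, hF, 0, fun t _ => ⟨u t, h t, 0, by simp, by
    simpa using isProdOfCommutators_zero N⟩⟩

theorem GrowthLE.comp_mul_left {C : ℝ} {u : ℝ → N} (hu : GrowthLE N C u) {r : ℝ} (hr : 0 ≤ r) :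
    GrowthLE N (r * C) fun t => u (r * t) := by
  obtain ⟨F, hF, K, hK⟩ := hu
  refine ⟨F, hF, K, fun t ht => ?_⟩
  obtain ⟨f, hf, m, hm, h⟩ := hK (r * t) (by positivity)
  exact ⟨f, hf, m, by linarith, h⟩

/-- Commutators have growth rate `0`. -/
theorem growthLE_conj_mul_inv (g : ℝ → G) (u v : ℝ → N)
    (h : ∀ t, (v t : G) = g t * u t * (g t)⁻¹ * (u t : G)⁻¹) : GrowthLE N 0 v :=
  GrowthLE.of_isProdOfCommutators (K := 1) fun t _ =>
    ⟨1, by simp, by rw [h]; exact isProdOfCommutators_one _ (u t).2⟩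

variable [N.Normal]

theorem GrowthLE.mul {C C' : ℝ} {u v : ℝ → N} (hu : GrowthLE N C u) (hv : GrowthLE N C' v) :
    GrowthLE N (C + C') (u * v) := by
  obtain ⟨F, hF, K, hK⟩ := hu
  obtain ⟨F', hF', K', hK'⟩ := hv
  refine ⟨Set.image2 (· * ·) F F', hF.image2 _ hF', K + K', fun t ht => ?_⟩
  obtain ⟨f, hf, m, hm, h⟩ := hK t ht
  obtain ⟨f', hf', m', hm', h'⟩ := hK' t ht
  refine ⟨f * f', ⟨f, hf, f', hf', rfl⟩, m + m', by push_cast; linarith, ?_⟩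
  convert (h.conj (f' : G)⁻¹).mul h' using 1
  simp only [Pi.mul_apply, Subgroup.coe_mul, Subgroup.coe_inv]
  group

theorem GrowthLE.inv {C : ℝ} {u : ℝ → N} (hu : GrowthLE N C u) : GrowthLE N C u⁻¹ := by
  obtain ⟨F, hF, K, hK⟩ := hu
  refine ⟨(·⁻¹) '' F, hF.image _, K, fun t ht => ?_⟩
  obtain ⟨f, hf, m, hm, h⟩ := hK t ht
  refine ⟨f⁻¹, ⟨f, hf, rfl⟩, m, hm, ?_⟩
  convert h.inv.conj (f : G) using 1
  simp only [Pi.inv_apply, Subgroup.coe_mul, Subgroup.coe_inv]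
  group

/-- The functions `ℝ → N` of growth rate `0`. -/
def boundedGrowth (N : Subgroup G) [N.Normal] : Subgroup (ℝ → N) where
  carrier := {u | GrowthLE N 0 u}
  one_mem' := growthLE_of_finite (Set.finite_singleton 1) fun _ => rfl
  mul_mem' hu hv := by simpa using GrowthLE.mul hu hv
  inv_mem' hu := hu.inv

instance : (boundedGrowth N).Normal where
  conj_mem u hu g := by
    have h1 : GrowthLE N 0 (g * u * g⁻¹ * u⁻¹) :=
      growthLE_conj_mul_inv (fun t => (g t : G)) u _ fun t => by simp
    have h2 := h1.mul hu
    rw [inv_mul_cancel_right, add_zero] at h2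
    exact h2

/-- The functions `ℝ → N` modulo those of growth rate `0`. -/
def GrowthClass (N : Subgroup G) [N.Normal] : Type _ := (ℝ → N) ⧸ boundedGrowth N

instance : Group (GrowthClass N) := inferInstanceAs (Group ((ℝ → N) ⧸ boundedGrowth N))

/-- The class of a function `ℝ → N`. -/
def GrowthClass.mk (N : Subgroup G) [N.Normal] : (ℝ → N) →* GrowthClass N :=
  QuotientGroup.mk' (boundedGrowth N)

theorem GrowthClass.mk_eq_mk {u v : ℝ → N} :
    GrowthClass.mk N u = GrowthClass.mk N v ↔ GrowthLE N 0 (u⁻¹ * v) :=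
  QuotientGroup.eq

/-- Commutators of functions have growth rate `0`, so that the quotient is commutative. -/
instance : CommGroup (GrowthClass N) where
  mul_comm a b := by
    obtain ⟨u, rfl⟩ := QuotientGroup.mk'_surjective (boundedGrowth N) a
    obtain ⟨v, rfl⟩ := QuotientGroup.mk'_surjective (boundedGrowth N) b
    change GrowthClass.mk N u * GrowthClass.mk N v = GrowthClass.mk N v * GrowthClass.mk N u
    rw [← map_mul, ← map_mul, GrowthClass.mk_eq_mk]
    exact growthLE_conj_mul_inv (fun t => (v t : G)⁻¹) u⁻¹ _ fun t => by simp [mul_assoc]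

theorem GrowthLE.congr {C : ℝ} {u v : ℝ → N} (hu : GrowthLE N C u)
    (h : GrowthClass.mk N u = GrowthClass.mk N v) : GrowthLE N C v := by
  have h1 := hu.mul (GrowthClass.mk_eq_mk.1 h)
  rwa [mul_inv_cancel_left, add_zero] at h1

/-- The class of `t ↦ x ^ ⌊r t⌋`, which is additive in the real number `r`. -/
noncomputable def powClass (x : N) : ℝ →+ Additive (GrowthClass N) :=
  AddMonoidHom.mk' (fun r => Additive.ofMul (GrowthClass.mk N fun t => x ^ ⌊r * t⌋)) (by
    intro r s
    rw [← ofMul_mul, ← map_mul]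
    refine congrArg Additive.ofMul (GrowthClass.mk_eq_mk.2 ?_)
    refine growthLE_of_finite (F := {1, x⁻¹}) (by simp) fun t => ?_
    have h1 := Int.le_floor_add (r * t) (s * t)
    have h2 := Int.le_floor_add_floor (r * t) (s * t)
    rw [← add_mul] at h1 h2
    have h3 : -⌊(r + s) * t⌋ + (⌊r * t⌋ + ⌊s * t⌋) = 0 ∨
        -⌊(r + s) * t⌋ + (⌊r * t⌋ + ⌊s * t⌋) = -1 := by omega
    simp only [Pi.mul_apply, Pi.inv_apply, ← zpow_add, ← zpow_neg]
    rcases h3 with h3 | h3 <;> simp [h3])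

/-- The additive map `ℝ[N] → (ℝ → N) / ∼` that sends a real chain `∑ rᵢ xᵢ` to the class of
`t ↦ ∏ xᵢ ^ ⌊rᵢ t⌋`. -/
noncomputable def chainClass (N : Subgroup G) [N.Normal] : (N →₀ ℝ) →+ Additive (GrowthClass N) :=
  Finsupp.liftAddHom powClass

theorem chainClass_single (x : N) (r : ℝ) :
    chainClass N (Finsupp.single x r) =
      Additive.ofMul (GrowthClass.mk N fun t => x ^ ⌊r * t⌋) :=
  (Finsupp.liftAddHom_apply_single powClass x r).trans rfl

theorem chainClass_smul {r : ℝ} (hr : 0 ≤ r) {v : N →₀ ℝ} {u : ℝ → N}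
    (h : chainClass N v = Additive.ofMul (GrowthClass.mk N u)) :
    chainClass N (r • v) = Additive.ofMul (GrowthClass.mk N fun t => u (r * t)) := by
  induction v using Finsupp.induction generalizing u with
  | zero =>
    have h1 : GrowthClass.mk N 1 = GrowthClass.mk N u := by
      rw [map_zero] at h
      rw [map_one]
      exact Additive.ofMul.injective h
    have h2 := (GrowthClass.mk_eq_mk.1 h1).comp_mul_left hr
    rw [smul_zero, map_zero, ← ofMul_one, ← map_one (GrowthClass.mk N)]
    refine congrArg Additive.ofMul (GrowthClass.mk_eq_mk.2 ?_)
    simpa using h2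
  | single_add x s v _ _ ih =>
    have h1 : chainClass N v =
        Additive.ofMul (GrowthClass.mk N ((fun t => x ^ ⌊s * t⌋)⁻¹ * u)) := by
      rw [map_mul, map_inv, ofMul_mul, ofMul_inv, ← h, map_add, chainClass_single,
        neg_add_cancel_left]
    rw [smul_add, map_add, ih h1, Finsupp.smul_single, chainClass_single, ← ofMul_mul, ← map_mul]
    congr 2
    funext t
    simp [mul_assoc, mul_left_comm s]

end Growth

/-! ### The growth seminorm on real chains -/

section Chains

variable {G : Type*} [Group G] {N : Subgroup G} [N.Normal]

/-- The chain `v = ∑ rᵢ xᵢ` has rate at most `C ≥ 0`: its class `t ↦ ∏ xᵢ ^ ⌊rᵢ t⌋` has a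
representative of growth rate at most `C`. -/
def HasRate (v : N →₀ ℝ) (C : ℝ) : Prop :=
  0 ≤ C ∧ ∃ u : ℝ → N, chainClass N v = Additive.ofMul (GrowthClass.mk N u) ∧ GrowthLE N C u

theorem hasRate_of_chainClass_eq_zero {v : N →₀ ℝ} (hv : chainClass N v = 0) : HasRate v 0 :=
  ⟨le_rfl, 1, by rw [hv, map_one, ofMul_one], (boundedGrowth N).one_mem⟩

theorem HasRate.add {v w : N →₀ ℝ} {C C' : ℝ} (hv : HasRate v C) (hw : HasRate w C') :
    HasRate (v + w) (C + C') := by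
  obtain ⟨hC, u, hu, hu'⟩ := hv
  obtain ⟨hC', z, hz, hz'⟩ := hw
  exact ⟨add_nonneg hC hC', u * z, by rw [map_add, hu, hz, map_mul, ofMul_mul], hu'.mul hz'⟩

theorem HasRate.neg {v : N →₀ ℝ} {C : ℝ} (hv : HasRate v C) : HasRate (-v) C := by
  obtain ⟨hC, u, hu, hu'⟩ := hv
  exact ⟨hC, u⁻¹, by rw [map_neg, hu, map_inv, ofMul_inv], hu'.inv⟩

theorem HasRate.smul {v : N →₀ ℝ} {C : ℝ} (hv : HasRate v C) (r : ℝ) :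
    HasRate (r • v) (|r| * C) := by
  have hpos : ∀ s : ℝ, 0 ≤ s → HasRate (s • v) (s * C) := by
    intro s hs
    obtain ⟨hC, u, hu, hu'⟩ := hv
    exact ⟨mul_nonneg hs hC, _, chainClass_smul hs hu, hu'.comp_mul_left hs⟩
  rcases le_total 0 r with hr | hr
  · rw [abs_of_nonneg hr]
    exact hpos r hr
  · rw [abs_of_nonpos hr]
    simpa using (hpos (-r) (neg_nonneg.2 hr)).neg

/-- The real chains of finite rate. -/
noncomputable def ratedChains (N : Subgroup G) [N.Normal] : Submodule ℝ (N →₀ ℝ) where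
  carrier := {v | ∃ C, HasRate v C}
  zero_mem' := ⟨0, hasRate_of_chainClass_eq_zero (map_zero _)⟩
  add_mem' := fun ⟨_, hv⟩ ⟨_, hw⟩ => ⟨_, hv.add hw⟩
  smul_mem' := fun r _ ⟨_, hv⟩ => ⟨_, hv.smul r⟩

theorem sInf_hasRate_le {v : N →₀ ℝ} {C : ℝ} (hv : HasRate v C) : sInf {C | HasRate v C} ≤ C :=
  csInf_le ⟨0, fun _ h => h.1⟩ hv

/-- The infimal rate of a chain of finite rate. -/
noncomputable def rateSeminorm (N : Subgroup G) [N.Normal] : Seminorm ℝ (ratedChains N) :=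
  Seminorm.ofSMulLE (fun v => sInf {C | HasRate (v : N →₀ ℝ) C})
    (le_antisymm (sInf_hasRate_le (hasRate_of_chainClass_eq_zero (map_zero _)))
      (Real.sInf_nonneg fun _ h => h.1))
    (fun v w => by
      refine le_of_forall_pos_le_add fun ε hε => ?_
      obtain ⟨C, hC, hlt⟩ := exists_lt_of_csInf_lt v.2
        (lt_add_of_pos_right (sInf {C | HasRate (v : N →₀ ℝ) C}) (half_pos hε))
      obtain ⟨C', hC', hlt'⟩ := exists_lt_of_csInf_lt w.2
        (lt_add_of_pos_right (sInf {C | HasRate (w : N →₀ ℝ) C}) (half_pos hε))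
      have h := sInf_hasRate_le (HasRate.add hC hC')
      rw [Submodule.coe_add]
      linarith)
    (fun r v => by
      rcases eq_or_ne r 0 with rfl | hr
      · rw [zero_smul, norm_zero, zero_mul]
        exact sInf_hasRate_le (hasRate_of_chainClass_eq_zero (map_zero _))
      · have hr' : 0 < ‖r‖ := norm_pos_iff.2 hr
        rw [← div_le_iff₀' hr']
        refine le_csInf v.2 fun C hC => ?_
        rw [div_le_iff₀' hr']
        exact sInf_hasRate_le (HasRate.smul hC r))

theorem rateSeminorm_le {v : N →₀ ℝ} {C : ℝ} (hv : HasRate v C) :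
    rateSeminorm N ⟨v, C, hv⟩ ≤ C := sInf_hasRate_le hv

/-- The relator `x ^ n - n x` has rate `0`. -/
theorem hasRate_zpow (x : N) (n : ℤ) :
    HasRate (Finsupp.single (x ^ n) 1 - Finsupp.single x (n : ℝ)) 0 := by
  refine hasRate_of_chainClass_eq_zero ?_
  have h : (n : ℝ) = n • (1 : ℝ) := by simp
  rw [h, ← Finsupp.smul_single, map_sub, map_zsmul, chainClass_single, chainClass_single,
    ← ofMul_zpow, ← map_zpow, sub_eq_zero]
  congr 2
  funext t
  simp only [Pi.pow_apply, ← zpow_mul, mul_comm]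

/-- The relator `g x g⁻¹ - x` has rate `0`. -/
theorem hasRate_conj (g : G) (x : N) :
    HasRate (Finsupp.single (MulAut.conjNormal g x) 1 - Finsupp.single x (1 : ℝ)) 0 := by
  refine hasRate_of_chainClass_eq_zero ?_
  rw [map_sub, chainClass_single, chainClass_single, ← ofMul_div, ← map_div, ← ofMul_one,
    ← map_one (GrowthClass.mk N), eq_comm]
  refine congrArg Additive.ofMul (GrowthClass.mk_eq_mk.2 ?_)
  refine growthLE_conj_mul_inv (fun _ => g) (fun t => x ^ ⌊1 * t⌋) _ fun t => ?_
  simp [div_eq_mul_inv, conj_zpow]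

/-- The relator `x y - x - y` has rate at most `1`: the class of `(x y) ^ ⌊t⌋ x ^ (-⌊t⌋) y ^ (-⌊t⌋)`
contains a product of `⌊t⌋` mixed commutators. -/
theorem hasRate_mul (x y : N) :
    HasRate (Finsupp.single (x * y) 1 - Finsupp.single x 1 - Finsupp.single y (1 : ℝ)) 1 := by
  refine ⟨zero_le_one, fun t => (x ^ ⌊1 * t⌋ * y ^ ⌊1 * t⌋)⁻¹ * (x * y) ^ ⌊1 * t⌋, ?_, ?_⟩
  · rw [map_sub, map_sub, chainClass_single, chainClass_single, chainClass_single, sub_sub,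
      ← ofMul_mul, ← ofMul_div, ← map_mul, div_eq_inv_mul, ← map_inv, ← map_mul]
    rfl
  · refine GrowthLE.of_isProdOfCommutators (K := 0) fun t ht => ?_
    obtain ⟨n, hn⟩ := Int.eq_ofNat_of_zero_le (Int.floor_nonneg.2 ht)
    refine ⟨n, ?_, ?_⟩
    · have h := Int.floor_le t
      rw [hn] at h
      simpa using h
    · simp only [one_mul, hn, zpow_natCast]
      exact isProdOfCommutators_mul_pow (x : G) y.2 n

theorem hasRate_single_of_mem {y : N} (hy : (y : G) ∈ mixedCommutator N) :
    HasRate (Finsupp.single y (1 : ℝ)) (cl N (y : G)) := by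
  refine ⟨by positivity, _, chainClass_single y 1, ?_⟩
  refine GrowthLE.of_isProdOfCommutators (K := 0) fun t ht => ?_
  obtain ⟨n, hn⟩ := Int.eq_ofNat_of_zero_le (Int.floor_nonneg.2 ht)
  refine ⟨n * cl N (y : G), ?_, ?_⟩
  · have h := Int.floor_le t
    rw [hn] at h
    have h' : (n : ℝ) ≤ t := by simpa using h
    rw [Nat.cast_mul, add_zero, mul_comm]
    exact mul_le_mul_of_nonneg_left h' (by positivity)
  · simp only [one_mul, hn]
    simpa using (isProdOfCommutators_cl hy).pow n

/-- The rate of the chain `y` is at least `scl_{G,N} y`: every representative of its class agrees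
with `t ↦ y ^ ⌊t⌋` up to a finite set and boundedly many commutators. -/
theorem scl_le_of_hasRate {y : N} (hy : (y : G) ∈ mixedCommutator N) {C : ℝ}
    (h : HasRate (Finsupp.single y (1 : ℝ)) C) : scl N (y : G) ≤ C := by
  obtain ⟨-, u, hu, hu'⟩ := h
  rw [chainClass_single] at hu
  obtain ⟨F, hF, K, hK⟩ := hu'.congr (Additive.ofMul.injective hu).symm
  obtain ⟨K', hK'⟩ := (hF.image fun f : N => (cl N (f : G) : ℝ)).bddAbove
  refine scl_le_of_cl_pow_le hy (K := K' + K) fun n => ?_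
  obtain ⟨f, hf, m, hm, hprod⟩ := hK n (by positivity)
  have h1 : ((f⁻¹ * y ^ ⌊1 * (n : ℝ)⌋ : N) : G) = (f : G)⁻¹ * (y : G) ^ n := by simp
  rw [h1] at hprod
  have hfmem : (f : G) ∈ mixedCommutator N := by
    have h2 := (mixedCommutator N).mul_mem ((mixedCommutator N).pow_mem hy n)
      ((mixedCommutator N).inv_mem hprod.mem)
    simpa using h2
  have h3 := ((isProdOfCommutators_cl hfmem).mul hprod).cl_le
  rw [mul_inv_cancel_left] at h3
  have h4 : (cl N (f : G) : ℝ) ≤ K' := hK' ⟨f, hf, rfl⟩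
  have h5 : (cl N ((y : G) ^ n) : ℝ) ≤ cl N (f : G) + m := by exact_mod_cast h3
  linarith

/-- A linear functional on real chains that is dominated by the growth seminorm on the chains of
finite rate is an invariant homogeneous quasimorphism on `N`. -/
theorem functional_mem_invQuasimorphisms (φ : (N →₀ ℝ) →ₗ[ℝ] ℝ) {D : ℝ} (hD : 0 ≤ D)
    (h : ∀ v : ratedChains N, |φ v| ≤ D * rateSeminorm N v) :
    (fun x : N => φ (Finsupp.single x 1)) ∈ invQuasimorphisms N := by
  have hle : ∀ {v : N →₀ ℝ} {C : ℝ}, HasRate v C → |φ v| ≤ D * C := fun hv =>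
    (h ⟨_, _, hv⟩).trans (mul_le_mul_of_nonneg_left (rateSeminorm_le hv) hD)
  have hzero : ∀ {v w : N →₀ ℝ}, HasRate (v - w) 0 → φ v = φ w := fun hv => by
    have h0 := hle hv
    rwa [mul_zero, abs_nonpos_iff, map_sub, sub_eq_zero] at h0
  refine ⟨⟨D * 1, fun x y => ?_⟩, fun x n => ?_, fun g x => hzero (hasRate_conj g x)⟩
  · simpa using hle (hasRate_mul x y)
  · change φ (Finsupp.single (x ^ n) 1) = n * φ (Finsupp.single x 1)
    rw [hzero (hasRate_zpow x n), ← smul_eq_mul, ← map_smul, Finsupp.smul_single, smul_eq_mul,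
      mul_one]

/-- A uniform form of Bavard duality: if every invariant homogeneous quasimorphism on `N` is
`O(q)` on `[G,N]`, then so is `scl_{G,N}`. -/
theorem exists_scl_le_of_forall_invQuasimorphisms (q : mixedCommutator N → ℝ)
    (hq : ∀ y, 0 < q y)
    (H : ∀ ν ∈ invQuasimorphisms N, ∃ K, ∀ y : mixedCommutator N,
      |ν (Subgroup.inclusion (mixedCommutator_le N) y)| ≤ K * q y) :
    ∃ K, ∀ y : mixedCommutator N, scl N (y : G) ≤ K * q y := by
  let v (y : mixedCommutator N) : ratedChains N :=
    ⟨Finsupp.single (Subgroup.inclusion (mixedCommutator_le N) y) 1, _,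
      hasRate_single_of_mem y.2⟩
  obtain ⟨K, hK⟩ := exists_seminorm_le_of_forall_functional (rateSeminorm N) v q hq
    (fun f ⟨C, hC⟩ => by
      obtain ⟨φ, rfl⟩ := f.exists_extend
      exact H _ (functional_mem_invQuasimorphisms φ (abs_nonneg C) fun v => (hC v).trans
        (mul_le_mul_of_nonneg_right (le_abs_self C) (apply_nonneg _ _))))
  exact ⟨K, fun y => (le_csInf (v y).2 fun C hC => scl_le_of_hasRate
    (y := Subgroup.inclusion (mixedCommutator_le N) y) y.2 hC).trans (hK y)⟩

end Chains

/-! ### Coarse homomorphisms from a basis of `𝒲(G,L,N)` -/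

section Comparison

variable {G : Type*} [Group G] {L N : Subgroup G} [L.Normal] [N.Normal]

theorem exists_invQuasimorphisms_basis (h : N ≤ L) {ℓ : ℕ} (hdim : dimW L N h = ℓ) :
    ∃ ν : Fin ℓ → N → ℝ, (∀ i, ν i ∈ invQuasimorphisms N) ∧ ∀ μ ∈ invQuasimorphisms N,
      ∃ a : Fin ℓ → ℝ, μ - ∑ i, a i • ν i ∈ invHoms N ⊔ restrictedQuasimorphisms L N h := by
  have hrank : Module.rank ℝ (WSpace L N h) = ℓ := by
    rw [dimW, Cardinal.toENat_eq_natCast] at hdim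
    exact hdim
  have : Module.Finite ℝ (WSpace L N h) :=
    Module.rank_lt_aleph0_iff.1 (hrank ▸ Cardinal.natCast_lt_aleph0)
  let b := Module.finBasisOfFinrankEq ℝ (WSpace L N h) (Module.finrank_eq_of_rank_eq hrank)
  choose ν hν using fun i => Submodule.mkQ_surjective _ (b i)
  refine ⟨fun i => ν i, fun i => (ν i).2, fun μ hμ => ?_⟩
  let μ' : invQuasimorphisms N := ⟨μ, hμ⟩
  let S := (invHoms N ⊔ restrictedQuasimorphisms L N h).submoduleOf (invQuasimorphisms N)
  refine ⟨fun i => b.repr (S.mkQ μ') i, ?_⟩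
  have hmem : μ' - ∑ i, b.repr (S.mkQ μ') i • ν i ∈ S := by
    rw [← Submodule.Quotient.mk_eq_zero, ← Submodule.mkQ_apply, map_sub, map_sum, sub_eq_zero]
    refine (b.sum_repr (S.mkQ μ')).symm.trans (Finset.sum_congr rfl fun i _ => ?_)
    rw [map_smul]
    exact congrArg _ (hν i).symm
  simpa [S, μ', Submodule.submoduleOf] using hmem

theorem exists_abs_le_mul_scl_of_mem_sup (h : N ≤ L) {μ : N → ℝ}
    (hμ : μ ∈ invHoms N ⊔ restrictedQuasimorphisms L N h) :
    ∃ C, 0 ≤ C ∧ ∀ y : N, (y : G) ∈ mixedCommutator N → |μ y| ≤ C * scl L (y : G) := by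
  obtain ⟨η, hη, _, ⟨ψ, hψ, rfl⟩, rfl⟩ := Submodule.mem_sup.1 hμ
  obtain ⟨C, hC, hψC⟩ := exists_abs_le_mul_scl hψ
  refine ⟨C, hC, fun y hy => ?_⟩
  rw [Pi.add_apply, invHoms_apply_eq_zero hη hy, zero_add]
  exact hψC (Subgroup.inclusion h y) (Subgroup.commutator_mono le_rfl h hy)

/-- If `ν₁, …, ν_ℓ` span `Q(N)^G` modulo `H¹(N)^G + i^* Q(L)^G`, then `scl_{G,N}` is bounded on
`[G,N]` in terms of `scl_{G,L}` and of the values of the `νᵢ`. -/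
theorem exists_scl_le (h : N ≤ L) {ℓ : ℕ} {ν : Fin ℓ → N → ℝ}
    (hν : ∀ μ ∈ invQuasimorphisms N, ∃ a : Fin ℓ → ℝ,
      μ - ∑ i, a i • ν i ∈ invHoms N ⊔ restrictedQuasimorphisms L N h) :
    ∃ K, ∀ y : N, (y : G) ∈ mixedCommutator N →
      scl N (y : G) ≤ K * (1 + (∑ i, |ν i y|) + scl L (y : G)) := by
  have hL : ∀ y : mixedCommutator N, 0 ≤ scl L (y : G) := fun y =>
    scl_nonneg (Subgroup.commutator_mono le_rfl h y.2)
  obtain ⟨K, hK⟩ := exists_scl_le_of_forall_invQuasimorphisms (N := N)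
    (fun y => 1 + (∑ i, |ν i (Subgroup.inclusion (mixedCommutator_le N) y)|) + scl L (y : G))
    (fun y => by
      have := hL y
      positivity)
    (fun μ hμ => by
      obtain ⟨a, ha⟩ := hν μ hμ
      obtain ⟨C, hC, hμC⟩ := exists_abs_le_mul_scl_of_mem_sup h ha
      refine ⟨(∑ i, |a i|) + C, fun y => ?_⟩
      set z : N := Subgroup.inclusion (mixedCommutator_le N) y
      have h1 := hμC z y.2
      have h2 : μ z = (μ - ∑ i, a i • ν i) z + ∑ i, a i * ν i z := by
        simp [Finset.sum_apply]
      have h3 : |∑ i, a i * ν i z| ≤ (∑ i, |a i|) * ∑ i, |ν i z| := by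
        refine (Finset.abs_sum_le_sum_abs _ _).trans ?_
        rw [Finset.sum_mul]
        refine Finset.sum_le_sum fun i hi => ?_
        rw [abs_mul]
        exact mul_le_mul_of_nonneg_left
          (Finset.single_le_sum (f := fun i => |ν i z|) (fun _ _ => abs_nonneg _) hi)
          (abs_nonneg _)
      have h4 := hL y
      have h5 : 0 ≤ ∑ i, |a i| := by positivity
      have h6 : 0 ≤ ∑ i, |ν i z| := by positivity
      calc |μ z| ≤ C * scl L (y : G) + (∑ i, |a i|) * ∑ i, |ν i z| := by
            rw [h2]
            exact (abs_add_le _ _).trans (add_le_add h1 h3)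
        _ ≤ ((∑ i, |a i|) + C) * (1 + (∑ i, |ν i z|) + scl L (y : G)) := by
            have := mul_nonneg h5 h4
            have := mul_nonneg hC h6
            linarith)
  exact ⟨K, fun y hy => hK ⟨y, hy⟩⟩

/-- The rounding `y ↦ (⌊ν₁ y⌋, …, ⌊ν_ℓ y⌋)` on `[G,N]` of a tuple of functions on `N`. -/
noncomputable def floorMap {ℓ : ℕ} (ν : Fin ℓ → N → ℝ) (y : mixedCommutator N) : Fin ℓ → ℤ :=
  fun i => ⌊ν i (Subgroup.inclusion (mixedCommutator_le N) y)⌋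

theorem abs_floor_sub_floor_le (a b : ℝ) : |(⌊a⌋ : ℝ) - ⌊b⌋| ≤ |a - b| + 1 := by
  have h1 := Int.floor_le a
  have h2 := Int.lt_floor_add_one a
  have h3 := Int.floor_le b
  have h4 := Int.lt_floor_add_one b
  have h5 := le_abs_self (a - b)
  have h6 := neg_abs_le (a - b)
  exact abs_le.2 ⟨by linarith, by linarith⟩

theorem abs_sub_le_abs_floor_sub_floor (a b : ℝ) : |a - b| ≤ |(⌊a⌋ : ℝ) - ⌊b⌋| + 1 := by
  have h1 := Int.floor_le a
  have h2 := Int.lt_floor_add_one a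
  have h3 := Int.floor_le b
  have h4 := Int.lt_floor_add_one b
  have h5 := le_abs_self ((⌊a⌋ : ℝ) - ⌊b⌋)
  have h6 := neg_abs_le ((⌊a⌋ : ℝ) - ⌊b⌋)
  exact abs_le.2 ⟨by linarith, by linarith⟩

theorem exists_common_defect {ℓ : ℕ} {ν : Fin ℓ → N → ℝ} (hν : ∀ i, ν i ∈ invQuasimorphisms N) :
    ∃ D, 0 ≤ D ∧ ∀ i, ∀ x y : N, |ν i (x * y) - ν i x - ν i y| ≤ D := by
  choose D hD using fun i => (hν i).1
  refine ⟨∑ i, |D i|, by positivity, fun i x y => (hD i x y).trans ((le_abs_self _).trans ?_)⟩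
  exact Finset.single_le_sum (f := fun i => |D i|) (fun _ _ => abs_nonneg _) (Finset.mem_univ i)

theorem isCoarseHom_floorMap {ℓ : ℕ} {ν : Fin ℓ → N → ℝ} (hν : ∀ i, ν i ∈ invQuasimorphisms N) :
    IsCoarseHom (dscl N) (floorMap ν) := by
  obtain ⟨D, hD0, hD⟩ := exists_common_defect hν
  let ι := Subgroup.inclusion (mixedCommutator_le N)
  constructor
  · intro S hS
    choose C hC0 hC using fun i => exists_abs_le_mul_scl (hν i)
    have hsum : 0 ≤ ∑ i, (C i * S + D + 1) := Finset.sum_nonneg fun i _ => by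
      have := mul_nonneg (hC0 i) hS.le
      linarith
    refine ⟨(∑ i, (C i * S + D + 1)) + 1, by linarith, fun y z hyz => ?_⟩
    have hle : l1Dist (floorMap ν y) (floorMap ν z) ≤ ∑ i, (C i * S + D + 1) := by
      refine Finset.sum_le_sum fun i _ => (abs_floor_sub_floor_le _ _).trans ?_
      have h1 := hD i (ι y) (ι (y⁻¹ * z))
      have h2 := hC i (ι (y⁻¹ * z)) (y⁻¹ * z).2
      have h3 : C i * scl N ((ι (y⁻¹ * z) : N) : G) ≤ C i * S :=
        mul_le_mul_of_nonneg_left hyz (hC0 i)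
      rw [← map_mul, mul_inv_cancel_left] at h1
      have h4 : |ν i (ι y) - ν i (ι z)| ≤ C i * S + D := by
        rw [abs_le] at *
        constructor <;> linarith [h1.1, h1.2, h2.1, h2.2]
      exact add_le_add h4 le_rfl
    linarith
  · refine ⟨∑ _i : Fin ℓ, (D + 2), fun y z => Finset.sum_le_sum fun i _ => ?_⟩
    have h1 := hD i (ι y) (ι z)
    rw [← map_mul] at h1
    have h2 := abs_le.1 h1
    have h3 := Int.floor_le (ν i (ι (y * z)))
    have h4 := Int.lt_floor_add_one (ν i (ι (y * z)))
    have h5 := Int.floor_le (ν i (ι y))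
    have h6 := Int.lt_floor_add_one (ν i (ι y))
    have h7 := Int.floor_le (ν i (ι z))
    have h8 := Int.lt_floor_add_one (ν i (ι z))
    have h9 : ((floorMap ν y + floorMap ν z) i : ℝ) = ⌊ν i (ι y)⌋ + ⌊ν i (ι z)⌋ := by
      simp [floorMap, ι]
    have h10 : (floorMap ν (y * z) i : ℝ) = ⌊ν i (ι (y * z))⌋ := rfl
    rw [h9, h10, abs_le]
    constructor <;> linarith [h2.1, h2.2]

/-- On a set where `scl_{G,L}` is bounded, the values of the `νᵢ` control `scl_{G,N}`. -/
theorem isCoarselyProper_floorMap (h : N ≤ L) {ℓ : ℕ} {ν : Fin ℓ → N → ℝ}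
    (hν : ∀ i, ν i ∈ invQuasimorphisms N)
    (hspan : ∀ μ ∈ invQuasimorphisms N, ∃ a : Fin ℓ → ℝ,
      μ - ∑ i, a i • ν i ∈ invHoms N ⊔ restrictedQuasimorphisms L N h)
    {A : Set (mixedCommutator N)} (hA : IsBoundedFor (dsclRestrict L N h) A) :
    IsCoarselyProper (restrictDist (dscl N) A) l1Dist fun a : A => floorMap ν a := by
  obtain ⟨D, hD0, hD⟩ := exists_common_defect hν
  obtain ⟨K, hK⟩ := exists_scl_le h hspan
  obtain ⟨B, hB⟩ := hA
  let ι := Subgroup.inclusion (mixedCommutator_le N)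
  intro S hS
  refine ⟨|K| * (1 + (S + ∑ _i : Fin ℓ, (D + 1)) + |B|) + 1, by positivity, ?_⟩
  rintro ⟨y, hy⟩ ⟨z, hz⟩ hlt
  by_contra! hle
  have hscl := hK (ι (y⁻¹ * z)) (y⁻¹ * z).2
  have h1 : ∑ i, |ν i (ι (y⁻¹ * z))| ≤ S + ∑ _i : Fin ℓ, (D + 1) := by
    refine le_trans ?_ (add_le_add hle le_rfl)
    rw [l1Dist, ← Finset.sum_add_distrib]
    refine Finset.sum_le_sum fun i _ => ?_
    have h2 := hD i (ι y) (ι (y⁻¹ * z))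
    rw [← map_mul, mul_inv_cancel_left] at h2
    have h3 := abs_sub_le_abs_floor_sub_floor (ν i (ι y)) (ν i (ι z))
    have h4 : |ν i (ι (y⁻¹ * z))| ≤ |ν i (ι y) - ν i (ι z)| + D := by
      rw [abs_sub_comm (ν i (ι y))]
      rw [abs_le] at h2 ⊢
      have h5 := le_abs_self (ν i (ι z) - ν i (ι y))
      have h6 := neg_abs_le (ν i (ι z) - ν i (ι y))
      constructor <;> linarith [h2.1, h2.2]
    have h7 : |ν i (ι (y⁻¹ * z))| ≤ |(⌊ν i (ι y)⌋ : ℝ) - ⌊ν i (ι z)⌋| + (D + 1) := by linarith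
    exact h7
  have h2 : scl L ((ι (y⁻¹ * z) : N) : G) ≤ |B| := (hB y hy z hz).trans (le_abs_self B)
  have h3 : 0 ≤ scl L ((ι (y⁻¹ * z) : N) : G) :=
    scl_nonneg (Subgroup.commutator_mono le_rfl h (y⁻¹ * z).2)
  have h4 : K * (1 + (∑ i, |ν i (ι (y⁻¹ * z))|) + scl L ((ι (y⁻¹ * z) : N) : G)) ≤
      |K| * (1 + (S + ∑ _i : Fin ℓ, (D + 1)) + |B|) :=
    mul_le_mul (le_abs_self K) (by linarith) (by positivity) (abs_nonneg K)
  have h5 : restrictDist (dscl N) A ⟨y, hy⟩ ⟨z, hz⟩ = scl N ((ι (y⁻¹ * z) : N) : G) := rfl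
  linarith

/-- If `𝒲(G,L,N)` has finite dimension `ℓ`, every `d_{scl_{G,L}}`-bounded set has a coarsely
proper coarse homomorphism to `ℤ^ℓ`. -/
theorem exists_isCoarseHomOn (h : N ≤ L) {ℓ : ℕ} (hdim : dimW L N h = ℓ)
    (A : Set (mixedCommutator N)) (hA : IsBoundedFor (dsclRestrict L N h) A) :
    ∃ α : A → Fin ℓ → ℤ, IsCoarseHomOn (dscl N) A α ∧
      IsCoarselyProper (restrictDist (dscl N) A) l1Dist α := by
  obtain ⟨ν, hν, hspan⟩ := exists_invQuasimorphisms_basis h hdim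
  exact ⟨fun a => floorMap ν a, ⟨floorMap ν, isCoarseHom_floorMap hν, fun _ => rfl⟩,
    isCoarselyProper_floorMap h hν hspan hA⟩

end Comparison

end MixedScl

theorem mainTheorem3 {G : Type*} [Group G] (L N : Subgroup G) [L.Normal] [N.Normal]
    (h : N ≤ L) :
    (⨅ (ℓ : ℕ) (_ : ∀ A : Set (mixedCommutator N), IsBoundedFor (dsclRestrict L N h) A →
          ∃ α : A → Fin ℓ → ℤ, IsCoarseHomOn (dscl N) A α ∧
            IsCoarselyProper (restrictDist (dscl N) A) l1Dist α), (ℓ : ℕ∞)) ≤ dimW L N h ∧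
    (⨆ (A : Set (mixedCommutator N)) (_ : IsBoundedFor (dsclRestrict L N h) A),
          asdim (restrictDist (dscl N) A)) ≤ dimW L N h := by
  rcases eq_or_ne (dimW L N h) ⊤ with htop | hne
  · rw [htop]
    exact ⟨le_top, le_top⟩
  obtain ⟨ℓ, hℓ⟩ := ENat.ne_top_iff_exists.1 hne
  rw [← hℓ]
  refine ⟨iInf₂_le ℓ (exists_isCoarseHomOn h hℓ.symm), iSup₂_le fun A hA => ?_⟩
  obtain ⟨α, ⟨β, ⟨hβ, -⟩, hαβ⟩, hα⟩ := exists_isCoarseHomOn h hℓ.symm A hA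
  have hcontrolled : IsControlled (restrictDist (dscl N) A) l1Dist α := by
    intro S hS
    obtain ⟨T, hT, hST⟩ := hβ S hS
    exact ⟨T, hT, fun a b hab => by rw [hαβ, hαβ]; exact hST a b hab⟩
  exact iInf₂_le ℓ ((asdimLE_l1Dist ℓ).of_isControlled hcontrolled hα)
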